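/- Let $\mathcal{C}$ be a category. The category $\mathrm{pro}\text{-}\mathcal{C}$ has as objects the diagrams $X \colon I \to \mathcal{C}$ indexed by small cofiltered categories $I$, and $\mathrm{Hom}(X,Y) = \lim_s \operatorname{colim}_t \mathrm{Hom}_{\mathcal{C}}(X_t, Y_s)$. Let $C$ be any class of maps in $\mathcal{C}$. A map $f \colon X \to Y$ in $\mathrm{pro}\text{-}\mathcal{C}$ is *essentially of type $C$* if it has a level representation by maps in $C$, that is, if there are a small cofiltered category $I$, functors $\tilde X, \tilde Y \colon I \to \mathcal{C}$, a natural transformation $\tilde f \colon \tilde X \to \tilde Y$ with $\tilde f_s \in C$ for every $s \in I$, and isomorphisms $X \cong \tilde X$ and $Y \cong \tilde Y$ in $\mathrm{pro}\text{-}\mathcal{C}$ under which $f$ corresponds to the map $\tilde X \to \tilde Y$ represented by the maps $\tilde f_s$. Then the maps in $\mathrm{pro}\text{-}\mathcal{C}$ that are essentially of type $C$ are closed under cofiltered limits. That is, for every small cofiltered category $J$, all limits of shape $J$ exist in $\mathrm{pro}\text{-}\mathcal{C}$, and if $X, Y \colon J \to \mathrm{pro}\text{-}\mathcal{C}$ are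 diagrams and $\alpha \colon X \to Y$ is a natural transformation such that $\alpha_j \colon X^j \to Y^j$ is essentially of type $C$ for every $j \in J$, then the induced map $\lim_j X^j \to \lim_j Y^j$ in $\mathrm{pro}\text{-}\mathcal{C}$ is essentially of type $C$. -/

import Mathlib

open CategoryTheory CategoryTheory.Limits Opposite

universe w v u

/-- A pro-object of `C`: a diagram in `C` indexed by a small (`w`-small) cofiltered category. -/
structure ProObj (C : Type u) [Category.{v} C] where
  /-- the small index category -/
  Index : Type w
  [smallCategory : SmallCategory.{w} Index]
  [isCofiltered : IsCofiltered Index]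
  /-- the diagram -/
  diag : Index ⥤ C

namespace ProObj

attribute [instance] ProObj.smallCategory ProObj.isCofiltered

variable {C : Type u} [Category.{v} C]

/-- The set `colim_t Hom_C(X_t, T)`, the colimit being taken over the opposite of the index
category of `X`. -/
abbrev HomColim (X : ProObj.{w} C) (T : C) : Type (max w v) :=
  (X.diag.op ⋙ yoneda.obj T).ColimitType

namespace HomColim

/-- The class in `colim_t Hom_C(X_t, T)` of a map `X_t ⟶ T`. -/
def mk (X : ProObj.{w} C) {T : C} (t : X.Index) (g : X.diag.obj t ⟶ T) : X.HomColim T :=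
  (X.diag.op ⋙ yoneda.obj T).ιColimitType (op t) g

theorem exists_rep {X : ProObj.{w} C} {T : C} (x : X.HomColim T) :
    ∃ (t : X.Index) (g : X.diag.obj t ⟶ T), mk X t g = x := by
  obtain ⟨t, g, h⟩ := Functor.ιColimitType_jointly_surjective _ x
  exact ⟨t.unop, g, h⟩

theorem mk_map_comp (X : ProObj.{w} C) {T : C} {t t' : X.Index} (a : t' ⟶ t)
    (g : X.diag.obj t ⟶ T) : mk X t' (X.diag.map a ≫ g) = mk X t g :=
  (X.diag.op ⋙ yoneda.obj T).ιColimitType_map a.op g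

/-- Maps out of `colim_t Hom_C(X_t, T)`: a compatible family of functions on the
`Hom_C(X_t, T)`. -/
def desc {X : ProObj.{w} C} {T : C} {S : Type*} (φ : ∀ t : X.Index, (X.diag.obj t ⟶ T) → S)
    (hφ : ∀ {t t' : X.Index} (a : t' ⟶ t) (g : X.diag.obj t ⟶ T),
      φ t' (X.diag.map a ≫ g) = φ t g) : X.HomColim T → S :=
  (X.diag.op ⋙ yoneda.obj T).descColimitType
    { pt := S
      ι := fun t g => φ t.unop g
      ι_naturality := fun a => funext fun g => hφ a.unop g }

@[simp]
theorem desc_mk {X : ProObj.{w} C} {T : C} {S : Type*}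
    (φ : ∀ t : X.Index, (X.diag.obj t ⟶ T) → S)
    (hφ : ∀ {t t' : X.Index} (a : t' ⟶ t) (g : X.diag.obj t ⟶ T),
      φ t' (X.diag.map a ≫ g) = φ t g) (t : X.Index) (g : X.diag.obj t ⟶ T) :
    desc φ hφ (mk X t g) = φ t g := rfl

/-- The function `colim_t Hom_C(X_t, T) → colim_t Hom_C(X_t, T')` given by composing with
`h : T ⟶ T'`. -/
def map (X : ProObj.{w} C) {T T' : C} (h : T ⟶ T') : X.HomColim T → X.HomColim T' :=
  desc (fun t g => mk X t (g ≫ h)) fun a g => by rw [Category.assoc, mk_map_comp]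

@[simp]
theorem map_mk (X : ProObj.{w} C) {T T' : C} (h : T ⟶ T') (t : X.Index)
    (g : X.diag.obj t ⟶ T) : map X h (mk X t g) = mk X t (g ≫ h) := rfl

theorem map_id (X : ProObj.{w} C) {T : C} (x : X.HomColim T) : map X (𝟙 T) x = x := by
  obtain ⟨t, g, rfl⟩ := exists_rep x
  simp

theorem map_comp (X : ProObj.{w} C) {T T' T'' : C} (h : T ⟶ T') (h' : T' ⟶ T'')
    (x : X.HomColim T) : map X (h ≫ h') x = map X h' (map X h x) := by
  obtain ⟨t, g, rfl⟩ := exists_rep x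
  simp

end HomColim

/-- The set `lim_s colim_t Hom_C(X_t, Y_s)`: families of elements of the
`colim_t Hom_C(X_t, Y_s)` that are compatible with the maps `Y_s ⟶ Y_s'`. -/
@[ext]
structure Hom (X Y : ProObj.{w} C) where
  /-- the component in `colim_t Hom_C(X_t, Y_s)` -/
  comp : ∀ s : Y.Index, X.HomColim (Y.diag.obj s)
  compat : ∀ {s s' : Y.Index} (b : s ⟶ s'), HomColim.map X (Y.diag.map b) (comp s) = comp s'

namespace Hom

/-- Precomposition of an element of `colim_s Hom_C(Y_s, T)` with a map of pro-objects `X → Y`: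
if `Y_s ⟶ T` represents the former and `X_t ⟶ Y_s` represents the component of the latter
at `s`, then the result is represented by the composite `X_t ⟶ Y_s ⟶ T`. -/
def precomp {X Y : ProObj.{w} C} (f : Hom X Y) {T : C} : Y.HomColim T → X.HomColim T :=
  HomColim.desc (fun s h => HomColim.map X h (f.comp s)) fun b h => by
    rw [HomColim.map_comp, f.compat]

@[simp]
theorem precomp_mk {X Y : ProObj.{w} C} (f : Hom X Y) {T : C} (s : Y.Index)
    (h : Y.diag.obj s ⟶ T) : f.precomp (HomColim.mk Y s h) = HomColim.map X h (f.comp s) := rfl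

theorem precomp_map {X Y : ProObj.{w} C} (f : Hom X Y) {T T' : C} (k : T ⟶ T')
    (y : Y.HomColim T) : f.precomp (HomColim.map Y k y) = HomColim.map X k (f.precomp y) := by
  obtain ⟨s, h, rfl⟩ := HomColim.exists_rep y
  simp [HomColim.map_comp]

end Hom

/-- The category of pro-objects of `C`, with `Hom(X, Y) = lim_s colim_t Hom_C(X_t, Y_s)`. -/
instance : Category.{max w v} (ProObj.{w} C) where
  Hom X Y := Hom X Y
  id X :=
    { comp := fun s => HomColim.mk X s (𝟙 _)
      compat := fun b => by
        rw [HomColim.map_mk, Category.id_comp, ← HomColim.mk_map_comp X b (𝟙 _),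
          Category.comp_id] }
  comp {X Y Z} f g :=
    { comp := fun r => Hom.precomp f (g.comp r)
      compat := fun c => by rw [← Hom.precomp_map, g.compat] }
  id_comp {X Y} f := by
    refine Hom.ext (funext fun s => ?_)
    dsimp only
    obtain ⟨t, g, hg⟩ := HomColim.exists_rep (f.comp s)
    rw [← hg]
    simp
  comp_id {X Y} f := by
    refine Hom.ext (funext fun s => ?_)
    exact HomColim.map_id X _
  assoc {X Y Z W} f g h := by
    refine Hom.ext (funext fun r => ?_)
    dsimp only
    obtain ⟨t, k, hk⟩ := HomColim.exists_rep (h.comp r)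
    rw [← hk]
    simp only [Hom.precomp_mk]
    rw [Hom.precomp_map]

/-- The pro-object given by a diagram on a small cofiltered category. -/
abbrev of {I : Type w} [SmallCategory I] [IsCofiltered I] (F : I ⥤ C) : ProObj.{w} C where
  Index := I
  diag := F

/-- The map of pro-objects represented by a natural transformation between two diagrams with
the same index category. -/
def levelMap {I : Type w} [SmallCategory I] [IsCofiltered I] {F G : I ⥤ C} (τ : F ⟶ G) :
    of F ⟶ of G :=
  Hom.mk (fun s => HomColim.mk (of F) s (τ.app s)) fun {s s'} b => by
    rw [HomColim.map_mk]
    exact (congrArg (HomColim.mk (of F) s) (τ.naturality b)).symm.trans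
      (HomColim.mk_map_comp (of F) b (τ.app s'))

/-- A level representation of a map `f : X ⟶ Y` of pro-objects: a small cofiltered category `I`,
two diagrams `source` and `target` on `I`, a natural transformation between them, and
isomorphisms of pro-objects of `X` and `Y` with these diagrams such that the natural
transformation represents `f`. -/
structure LevelRepresentation {X Y : ProObj.{w} C} (f : X ⟶ Y) where
  /-- the common index category -/
  I : Type w
  [smallCategory : SmallCategory.{w} I]
  [isCofiltered : IsCofiltered I]
  /-- the diagram isomorphic to `X` -/
  source : I ⥤ C
  /-- the diagram isomorphic to `Y` -/
  target : I ⥤ C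
  /-- the levelwise maps -/
  natTrans : source ⟶ target
  /-- the isomorphism of `X` with the first diagram -/
  sourceIso : X ≅ of source
  /-- the isomorphism of `Y` with the second diagram -/
  targetIso : Y ≅ of target
  comm : f ≫ targetIso.hom = sourceIso.hom ≫ levelMap natTrans

attribute [instance] LevelRepresentation.smallCategory LevelRepresentation.isCofiltered

/-- A level representation is of type `W`, for a class `W` of maps of `C`, if each of its
levelwise maps belongs to `W`. -/
def LevelRepresentation.IsOfType {X Y : ProObj.{w} C} {f : X ⟶ Y} (L : LevelRepresentation f)
    (W : MorphismProperty C) : Prop :=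
  ∀ s : L.I, W (L.natTrans.app s)

/-- The class of maps of pro-objects that are essentially of type `W`: those which have a level
representation of type `W`. -/
def essentiallyOfType (W : MorphismProperty C) : MorphismProperty (ProObj.{w} C) :=
  fun _ _ f => ∃ L : LevelRepresentation f, L.IsOfType W

end ProObj

/-! A map is essentially of type `W` exactly when, as an arrow of pro-objects, it comes from a
pro-object of `ArrowsIn W`, the full subcategory of the arrow category on the maps in `W`. The
comparison functor `proToArrow` is fully faithful, because a commutative square of pro-objects
already commutes at some level. Hence a `J`-diagram of such maps lifts to a diagram `Q` of
pro-objects of `ArrowsIn W`. The limit of `Q` is levelwise in `W`, and the source and target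
functors preserve it (`isLimitMapProLimitCone`), so it is a level representation of the induced map.

The limit of `P : J ⥤ ProObj E` is a single diagram indexed by the pairs `(j, s)` with `s` an index
of `P j`. An arrow of pairs is some `u` in `J` together with a map of `E` representing a component
of `P u`. These arrows need not form a `w`-small type, so `LimitIndex` keeps only the composites of
index maps and of one chosen representative per component. This is enough for cofilteredness, and a
map into the resulting pro-object is still the same as a cone. The argument is levelwise, so it
survives applying any functor `F : E ⥤ C`. -/

namespace ProObj

/-! ### Representatives in the filtered colimits of Hom-sets. -/

section Basic

variable {C : Type u} [Category.{v} C]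

namespace HomColim

theorem exists_map_comp_eq {X : ProObj.{w} C} {T : C} {t t' : X.Index}
    {g : X.diag.obj t ⟶ T} {g' : X.diag.obj t' ⟶ T} (h : mk X t g = mk X t' g') :
    ∃ (r : X.Index) (a : r ⟶ t) (b : r ⟶ t'), X.diag.map a ≫ g = X.diag.map b ≫ g' := by
  have h' := ((X.diag.op ⋙ yoneda.obj T).ιColimitType_eq_iff g g').1 h
  rw [← Types.FilteredColimit.rel_eq_eqvGen_colimitTypeRel] at h'
  obtain ⟨k, a, b, hab⟩ := h'
  exact ⟨k.unop, a.unop, b.unop, hab⟩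

theorem exists_map_comp_eq' {X : ProObj.{w} C} {T : C} {t : X.Index}
    {g g' : X.diag.obj t ⟶ T} (h : mk X t g = mk X t g') :
    ∃ (r : X.Index) (a : r ⟶ t), X.diag.map a ≫ g = X.diag.map a ≫ g' := by
  obtain ⟨r, a, b, hab⟩ := exists_map_comp_eq h
  -- The arrows `a` and `b` may differ, so they are equalized in the index category.
  refine ⟨IsCofiltered.eq a b, IsCofiltered.eqHom a b ≫ a, ?_⟩
  conv_rhs => rw [IsCofiltered.eq_condition a b]
  simp only [Functor.map_comp, Category.assoc, hab]

theorem exists_rep₂ {X : ProObj.{w} C} {T T' : C} (x : X.HomColim T) (y : X.HomColim T') :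
    ∃ (t : X.Index) (g : X.diag.obj t ⟶ T) (h : X.diag.obj t ⟶ T'),
      mk X t g = x ∧ mk X t h = y := by
  obtain ⟨t, g, rfl⟩ := exists_rep x
  obtain ⟨t', h, rfl⟩ := exists_rep y
  exact ⟨IsCofiltered.min t t', X.diag.map (IsCofiltered.minToLeft t t') ≫ g,
    X.diag.map (IsCofiltered.minToRight t t') ≫ h, mk_map_comp _ _ _, mk_map_comp _ _ _⟩

end HomColim

@[ext]
theorem hom_ext {X Y : ProObj.{w} C} {f g : X ⟶ Y} (h : ∀ s, Hom.comp f s = Hom.comp g s) :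
    f = g :=
  Hom.ext (funext h)

theorem id_comp_index (X : ProObj.{w} C) (s : X.Index) :
    Hom.comp (𝟙 X) s = HomColim.mk X s (𝟙 _) := rfl

theorem comp_comp_index {X Y Z : ProObj.{w} C} (f : X ⟶ Y) (g : Y ⟶ Z) (r : Z.Index) :
    Hom.comp (f ≫ g) r = Hom.precomp f (Hom.comp g r) := rfl

theorem hom_comp_map {X Y : ProObj.{w} C} (f : X ⟶ Y) {s s' : Y.Index} (b : s ⟶ s') :
    HomColim.map X (Y.diag.map b) (Hom.comp f s) = Hom.comp f s' :=
  Hom.compat f b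

theorem precomp_mk_hom {X Y : ProObj.{w} C} (f : X ⟶ Y) {T : C} (s : Y.Index)
    (h : Y.diag.obj s ⟶ T) :
    Hom.precomp f (HomColim.mk Y s h) = HomColim.map X h (Hom.comp f s) := rfl

end Basic

/-! ### Functoriality of pro-objects in the base category. -/

section MapPro

variable {E : Type*} [Category* E] {C : Type u} [Category.{v} C]

/-- The image of a pro-object under a functor, computed levelwise. -/
abbrev mapObj (F : E ⥤ C) (X : ProObj.{w} E) : ProObj.{w} C := of (X.diag ⋙ F)

/-- The function `colim_t Hom_E(X_t, T) → colim_t Hom_C(F X_t, F T)`. -/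
def HomColim.mapFunctor (F : E ⥤ C) {X : ProObj.{w} E} {T : E} :
    X.HomColim T → (mapObj F X).HomColim (F.obj T) :=
  HomColim.desc (fun t g => HomColim.mk (mapObj F X) t (F.map g)) fun a g => by
    rw [F.map_comp]
    exact HomColim.mk_map_comp (mapObj F X) a (F.map g)

@[simp]
theorem HomColim.mapFunctor_mk (F : E ⥤ C) {X : ProObj.{w} E} {T : E} (t : X.Index)
    (g : X.diag.obj t ⟶ T) :
    HomColim.mapFunctor F (HomColim.mk X t g) = HomColim.mk (mapObj F X) t (F.map g) := rfl

theorem HomColim.mapFunctor_map (F : E ⥤ C) {X : ProObj.{w} E} {T T' : E} (h : T ⟶ T')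
    (x : X.HomColim T) :
    HomColim.mapFunctor F (HomColim.map X h x) =
      HomColim.map (mapObj F X) (F.map h) (HomColim.mapFunctor F x) := by
  obtain ⟨t, g, rfl⟩ := HomColim.exists_rep x
  simp

/-- The functor between categories of pro-objects induced by a functor. -/
def mapPro (F : E ⥤ C) : ProObj.{w} E ⥤ ProObj.{w} C where
  obj X := mapObj F X
  map {X Y} f := Hom.mk (fun s => HomColim.mapFunctor F (Hom.comp f s)) fun b => by
    refine (HomColim.mapFunctor_map F _ _).symm.trans ?_
    rw [hom_comp_map]
  map_id X := by
    ext s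
    exact congrArg (HomColim.mk (mapObj F X) s) (F.map_id _)
  map_comp {X Y Z} f g := by
    ext s
    change HomColim.mapFunctor F (Hom.precomp f (Hom.comp g s)) =
      Hom.precomp _ (HomColim.mapFunctor F (Hom.comp g s))
    obtain ⟨t, h, ht⟩ := HomColim.exists_rep (Hom.comp g s)
    rw [← ht]
    exact HomColim.mapFunctor_map F _ _

theorem mapPro_map_comp (F : E ⥤ C) {X Y : ProObj.{w} E} (f : X ⟶ Y) (s : Y.Index) :
    Hom.comp ((mapPro F).map f) s = HomColim.mapFunctor F (Hom.comp f s) := rfl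

/-- The natural transformation induced on pro-objects by a natural transformation. -/
def mapProNatTrans {F G : E ⥤ C} (τ : F ⟶ G) : mapPro.{w} F ⟶ mapPro G where
  app X := levelMap (Functor.whiskerLeft X.diag τ)
  naturality {X Y} f := by
    ext s
    obtain ⟨t, g, hg⟩ := HomColim.exists_rep (Hom.comp f s)
    change HomColim.map (mapObj F X) (τ.app (Y.diag.obj s))
        (HomColim.mapFunctor F (Hom.comp f s)) =
      Hom.precomp (levelMap (Functor.whiskerLeft X.diag τ))
        (HomColim.mapFunctor G (Hom.comp f s))
    rw [← hg]
    exact congrArg (HomColim.mk (mapObj F X) t) (τ.naturality g)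

/-- The identity functor induces the identity on pro-objects. -/
def mapProId : mapPro.{w} (𝟭 C) ≅ 𝟭 (ProObj.{w} C) :=
  NatIso.ofComponents (fun X => Iso.refl X) fun {X Y} f => by
    ext s
    obtain ⟨t, g, hg⟩ := HomColim.exists_rep (Hom.comp f s)
    refine (HomColim.map_id _ _).trans ?_
    rw [mapPro_map_comp, comp_comp_index]
    change _ = Hom.precomp (𝟙 X) (Hom.comp f s)
    rw [← hg]
    exact congrArg (HomColim.mk X t) (Category.id_comp _).symm

end MapPro

end ProObj

namespace ProObj

/-! ### Construction of cofiltered limits of pro-objects. -/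

section CofilteredLimits

variable {E : Type u} [Category.{v} E] {J : Type w} [SmallCategory.{w} J]

/-- The objects of the index categories of all the pro-objects of a diagram. -/
structure TotalIndex (P : J ⥤ ProObj.{w} E) : Type w where
  /-- the index of the pro-object -/
  base : J
  /-- the index in this pro-object -/
  level : (P.obj base).Index

variable (P : J ⥤ ProObj.{w} E)

/-- Maps between the levels of the pro-objects of a diagram which represent the components of
the transition maps. -/
@[ext]
structure TotalHom (x y : TotalIndex P) where
  /-- the map of the base category -/
  base : x.base ⟶ y.base
  /-- the representing map -/
  hom : (P.obj x.base).diag.obj x.level ⟶ (P.obj y.base).diag.obj y.level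
  mk_hom : HomColim.mk (P.obj x.base) x.level hom = Hom.comp (P.map base) y.level

instance : Category (TotalIndex P) where
  Hom := TotalHom P
  id x :=
    { base := 𝟙 _
      hom := 𝟙 _
      mk_hom := by rw [P.map_id]; rfl }
  comp {x y z} f g :=
    { base := f.base ≫ g.base
      hom := f.hom ≫ g.hom
      mk_hom := by
        rw [P.map_comp, comp_comp_index, ← g.mk_hom, precomp_mk_hom, ← f.mk_hom]
        rfl }
  id_comp f := TotalHom.ext (Category.id_comp _) (Category.id_comp _)
  comp_id f := TotalHom.ext (Category.comp_id _) (Category.comp_id _)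
  assoc f g h := TotalHom.ext (Category.assoc _ _ _) (Category.assoc _ _ _)

/-- The diagram of all the levels of a diagram of pro-objects. -/
def totalDiag : TotalIndex P ⥤ E where
  obj x := (P.obj x.base).diag.obj x.level
  map f := TotalHom.hom f

/-- The map of total indices given by a map in one of the index categories. -/
def TotalHom.ofLevel {j : J} {s s' : (P.obj j).Index} (a : s ⟶ s') :
    (⟨j, s⟩ : TotalIndex P) ⟶ ⟨j, s'⟩ where
  base := 𝟙 j
  hom := (P.obj j).diag.map a
  mk_hom := by
    rw [P.map_id, id_comp_index, ← HomColim.mk_map_comp _ a, Category.comp_id]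

theorem exists_totalHom {j j' : J} (u : j ⟶ j') (s : (P.obj j').Index) :
    ∃ (t : (P.obj j).Index) (f : (⟨j, t⟩ : TotalIndex P) ⟶ ⟨j', s⟩), TotalHom.base f = u := by
  obtain ⟨t, g, h⟩ := HomColim.exists_rep (Hom.comp (P.map u) s)
  exact ⟨t, ⟨u, g, h⟩, rfl⟩

/-- The level of a chosen representative of a component of a transition map. -/
noncomputable def repLevel {j j' : J} (u : j ⟶ j') (s : (P.obj j').Index) : (P.obj j).Index :=
  (exists_totalHom P u s).choose

/-- A chosen representative of a component of a transition map. -/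
noncomputable def rep {j j' : J} (u : j ⟶ j') (s : (P.obj j').Index) :
    (⟨j, repLevel P u s⟩ : TotalIndex P) ⟶ ⟨j', s⟩ :=
  (exists_totalHom P u s).choose_spec.choose

theorem rep_base {j j' : J} (u : j ⟶ j') (s : (P.obj j').Index) :
    TotalHom.base (rep P u s) = u :=
  (exists_totalHom P u s).choose_spec.choose_spec

/-- A small type of generators of the maps between total indices. -/
inductive Generator : TotalIndex P → TotalIndex P → Type w
  | level {j : J} {s s' : (P.obj j).Index} (a : s ⟶ s') : Generator ⟨j, s⟩ ⟨j, s'⟩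
  | rep {j j' : J} (u : j ⟶ j') (s : (P.obj j').Index) : Generator ⟨j, repLevel P u s⟩ ⟨j', s⟩

/-- The quiver on the total indices whose arrows are the generators. -/
def GeneratorQuiver : Type w := TotalIndex P

instance : Quiver.{w} (GeneratorQuiver P) := ⟨Generator P⟩

/-- The map of total indices given by a generator. -/
noncomputable def Generator.toHom : ∀ {x y : TotalIndex P}, Generator P x y → (x ⟶ y)
  | _, _, .level a => TotalHom.ofLevel P a
  | _, _, .rep u s => ProObj.rep P u s

/-- The evaluation of paths of generators. -/
noncomputable def evalPaths : Paths (GeneratorQuiver P) ⥤ TotalIndex P :=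
  Paths.lift { obj := fun x => x, map := fun f => Generator.toHom P f }

/-- The index category of the limit of a diagram of pro-objects: its maps are the maps of total
indices which are composites of generators. -/
abbrev LimitIndex : Type w := CategoryTheory.Quotient (evalPaths P).homRel

/-- The faithful functor from the index category of the limit to the total indices. -/
noncomputable def limitIndexFunctor : LimitIndex P ⥤ TotalIndex P :=
  CategoryTheory.Quotient.lift _ (evalPaths P) fun _ _ _ _ h => h

/-- The congruence on paths is equality after evaluation, so equations in `LimitIndex` can be
checked in `TotalIndex`. -/
instance : (limitIndexFunctor P).Faithful :=
  inferInstanceAs (CategoryTheory.Quotient.lift (evalPaths P).homRel (evalPaths P) _).Faithful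

/-- An index of the limit. -/
abbrev limitIndex (j : J) (s : (P.obj j).Index) : LimitIndex P :=
  ⟨(⟨j, s⟩ : TotalIndex P)⟩

/-- The map between indices of the limit given by a generator. -/
def Generator.toLimitHom {x y : TotalIndex P} (f : Generator P x y) :
    (⟨x⟩ : LimitIndex P) ⟶ ⟨y⟩ :=
  (CategoryTheory.Quotient.functor _).map ((Paths.of (GeneratorQuiver P)).map f)

theorem limitIndexFunctor_map_toLimitHom {x y : TotalIndex P} (f : Generator P x y) :
    (limitIndexFunctor P).map (f.toLimitHom P) = f.toHom P :=
  Paths.lift_toPath _ _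

variable {P}

/-- The chosen representatives lift every arrow of `J` with prescribed target, which reduces
cofilteredness to that of `J` and of the index categories. -/
theorem exists_limitHom_over {j : J} (x : LimitIndex P) (u : j ⟶ TotalIndex.base x.as) :
    ∃ (t : (P.obj j).Index) (f : limitIndex P j t ⟶ x),
      TotalHom.base ((limitIndexFunctor P).map f) = u := by
  obtain ⟨⟨j', s⟩⟩ := x
  exact ⟨_, (Generator.rep u s).toLimitHom P,
    (congrArg TotalHom.base (limitIndexFunctor_map_toLimitHom P _)).trans (rep_base P u s)⟩

/-- The map between indices of the limit given by a map in one of the index categories. -/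
def limitIndexMap {j : J} {s s' : (P.obj j).Index} (a : s ⟶ s') :
    limitIndex P j s ⟶ limitIndex P j s' :=
  (Generator.level a).toLimitHom P

theorem limitIndexFunctor_map_limitIndexMap {j : J} {s s' : (P.obj j).Index} (a : s ⟶ s') :
    (limitIndexFunctor P).map (limitIndexMap a) = TotalHom.ofLevel P a :=
  limitIndexFunctor_map_toLimitHom P _

instance [IsCofiltered J] : IsCofiltered (LimitIndex P) where
  cone_objs x y := by
    obtain ⟨t, f, -⟩ := exists_limitHom_over x (IsCofiltered.minToLeft _ (TotalIndex.base y.as))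
    obtain ⟨t', f', -⟩ := exists_limitHom_over y (IsCofiltered.minToRight (TotalIndex.base x.as) _)
    exact ⟨limitIndex P _ (IsCofiltered.min t t'),
      limitIndexMap (IsCofiltered.minToLeft t t') ≫ f,
      limitIndexMap (IsCofiltered.minToRight t t') ≫ f', trivial⟩
  cone_maps x y p q := by
    let p' := (limitIndexFunctor P).map p
    let q' := (limitIndexFunctor P).map q
    obtain ⟨t, f, hf⟩ := exists_limitHom_over x
      (IsCofiltered.eqHom (TotalHom.base p') (TotalHom.base q'))
    let f' := (limitIndexFunctor P).map f
    have hbase : TotalHom.base (f' ≫ p') = TotalHom.base (f' ≫ q') := by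
      change TotalHom.base f' ≫ TotalHom.base p' = TotalHom.base f' ≫ TotalHom.base q'
      rw [hf]
      exact IsCofiltered.eq_condition _ _
    -- Once the bases agree, both composites represent the same component of one transition map, so
    -- an index map `a` equalizes them; `a` is itself a generator.
    obtain ⟨r, a, ha⟩ := HomColim.exists_map_comp_eq' ((TotalHom.mk_hom (f' ≫ p')).trans
      ((congrArg (fun b => Hom.comp (P.map b) _) hbase).trans (TotalHom.mk_hom (f' ≫ q')).symm))
    let e : limitIndex P _ r ⟶ limitIndex P _ t := limitIndexMap a
    have he : (limitIndexFunctor P).map e = TotalHom.ofLevel P a :=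
      limitIndexFunctor_map_limitIndexMap a
    refine ⟨limitIndex P _ r, e ≫ f, (limitIndexFunctor P).map_injective ?_⟩
    rw [Category.assoc, Category.assoc, Functor.map_comp, Functor.map_comp, Functor.map_comp,
      Functor.map_comp, he]
    exact TotalHom.ext (congrArg (fun b => 𝟙 _ ≫ b) hbase) ha
  nonempty := by
    obtain ⟨j⟩ := IsCofiltered.nonempty (C := J)
    obtain ⟨s⟩ := IsCofiltered.nonempty (C := (P.obj j).Index)
    exact ⟨limitIndex P j s⟩

variable (P)

variable {C : Type*} [Category* C] (F : E ⥤ C)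

/-- The components of a cone, taken over all pairs, are compatible and so define a map into the
limit. -/
theorem cone_comp_totalHom (c : Cone (P ⋙ mapPro F)) {x y : TotalIndex P} (f : x ⟶ y) :
    HomColim.map c.pt (F.map (TotalHom.hom f)) (Hom.comp (c.π.app x.base) x.level) =
      Hom.comp (c.π.app y.base) y.level := by
  rw [← c.w (TotalHom.base f)]
  change _ = Hom.precomp (c.π.app x.base)
    (HomColim.mapFunctor F (Hom.comp (P.map (TotalHom.base f)) y.level))
  rw [← TotalHom.mk_hom f]
  rfl

variable [IsCofiltered J]

/-- The limit of a cofiltered diagram of pro-objects. -/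
noncomputable abbrev limitObj : ProObj.{w} E := of (limitIndexFunctor P ⋙ totalDiag P)

theorem limitObj_mk_id {x y : LimitIndex P} (f : x ⟶ y) :
    HomColim.mk (limitObj P) x (TotalHom.hom ((limitIndexFunctor P).map f)) =
      HomColim.mk (limitObj P) y (𝟙 ((totalDiag P).obj y.as)) := by
  refine Eq.trans ?_ (HomColim.mk_map_comp (limitObj P) f _)
  exact congrArg (HomColim.mk (limitObj P) x) (Category.comp_id _).symm

/-- The projections from the limit of a cofiltered diagram of pro-objects. -/
noncomputable def limitProj (j : J) : limitObj P ⟶ P.obj j :=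
  Hom.mk (fun s => HomColim.mk (limitObj P) (limitIndex P j s) (𝟙 _)) fun {s s'} b => by
    refine Eq.trans ?_ (limitObj_mk_id P (limitIndexMap b))
    rw [limitIndexFunctor_map_limitIndexMap]
    exact congrArg (HomColim.mk (limitObj P) _) (Category.id_comp _)

theorem limitProj_comp (j : J) (s : (P.obj j).Index) :
    Hom.comp (limitProj P j) s = HomColim.mk (limitObj P) (limitIndex P j s) (𝟙 _) := rfl

theorem limitProj_naturality {j j' : J} (u : j ⟶ j') :
    limitProj P j ≫ P.map u = limitProj P j' := by
  ext s
  have h := TotalHom.mk_hom (rep P u s)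
  rw [rep_base] at h
  rw [comp_comp_index, ← h, precomp_mk_hom, limitProj_comp, limitProj_comp]
  refine Eq.trans ?_ (limitObj_mk_id P ((Generator.rep u s).toLimitHom P))
  rw [limitIndexFunctor_map_toLimitHom]
  exact congrArg (HomColim.mk (limitObj P) _) (Category.id_comp _)

/-- The limit cone of a cofiltered diagram of pro-objects. -/
noncomputable def limitCone : Cone P where
  pt := limitObj P
  π :=
    { app := limitProj P
      naturality := fun _ _ u => (Category.id_comp _).trans (limitProj_naturality P u).symm }

/-- The map to the image of the limit induced by a cone. -/
noncomputable def limitLift (c : Cone (P ⋙ mapPro F)) : c.pt ⟶ (mapPro F).obj (limitObj P) :=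
  Hom.mk (fun x => Hom.comp (c.π.app (TotalIndex.base x.as)) (TotalIndex.level x.as))
    fun f => cone_comp_totalHom P F c ((limitIndexFunctor P).map f)

/-- Projections are represented by identities, so `m` is determined by its composites with them;
this gives both factorization and uniqueness. -/
theorem comp_mapPro_limitProj_comp {Z : ProObj.{w} C} (m : Z ⟶ (mapPro F).obj (limitObj P))
    (j : J) (s : (P.obj j).Index) :
    Hom.comp (m ≫ (mapPro F).map (limitProj P j)) s = Hom.comp m (limitIndex P j s) := by
  refine Eq.trans ?_ (HomColim.map_id Z _)
  change HomColim.map Z (F.map (𝟙 _)) _ = _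
  rw [F.map_id]
  rfl

/-- The functor on pro-objects induced by a functor preserves cofiltered limits. -/
noncomputable def isLimitMapProLimitCone : IsLimit ((mapPro F).mapCone (limitCone P)) where
  lift c := limitLift P F c
  fac c j := by
    ext s
    exact comp_mapPro_limitProj_comp P F _ j s
  uniq c m hm := by
    ext x
    refine (comp_mapPro_limitProj_comp P F m (TotalIndex.base x.as)
      (TotalIndex.level x.as)).symm.trans ?_
    have h : m ≫ (mapPro F).map (limitProj P (TotalIndex.base x.as)) = c.π.app _ :=
      hm (TotalIndex.base x.as)
    exact congr_fun (congrArg Hom.comp h) (TotalIndex.level x.as)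

instance : HasLimitsOfShape J (ProObj.{w} E) where
  has_limit P :=
    -- The case `F = 𝟭 E` of preservation is existence itself, up to `mapProId`.
    have : HasLimit (P ⋙ mapPro (𝟭 E)) := ⟨_, isLimitMapProLimitCone P (𝟭 E)⟩
    hasLimit_of_iso (Functor.isoWhiskerLeft P mapProId ≪≫ P.rightUnitor)

end CofilteredLimits

end ProObj

namespace ProObj

/-! ### Pro-objects of arrows versus arrows of pro-objects. -/

section Arrows

variable {C : Type u} [Category.{v} C] (W : MorphismProperty C)

/-- The full subcategory of the arrow category given by a class of maps. -/
abbrev ArrowsIn := ObjectProperty.FullSubcategory (fun f : Arrow C => W f.hom)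

/-- The source functor. -/
def srcFunctor : ArrowsIn W ⥤ C := ObjectProperty.ι _ ⋙ Arrow.leftFunc

/-- The target functor. -/
def tgtFunctor : ArrowsIn W ⥤ C := ObjectProperty.ι _ ⋙ Arrow.rightFunc

/-- The universal map from the source to the target. -/
def srcToTgt : srcFunctor W ⟶ tgtFunctor W := Functor.whiskerLeft _ Arrow.leftToRight

variable {W}

/-- A commutative square gives a map in the category of arrows. -/
def arrowsInHomMk {a b : ArrowsIn W} (g : (srcFunctor W).obj a ⟶ (srcFunctor W).obj b)
    (h : (tgtFunctor W).obj a ⟶ (tgtFunctor W).obj b)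
    (w : g ≫ (srcToTgt W).app b = (srcToTgt W).app a ≫ h) : a ⟶ b :=
  ObjectProperty.homMk (Arrow.homMk g h w)

theorem arrowsIn_hom_ext {a b : ArrowsIn W} {f g : a ⟶ b}
    (hs : (srcFunctor W).map f = (srcFunctor W).map g)
    (ht : (tgtFunctor W).map f = (tgtFunctor W).map g) : f = g :=
  ObjectProperty.hom_ext _ (Arrow.hom_ext _ _ hs ht)

theorem HomColim.arrowsIn_ext {X : ProObj.{w} (ArrowsIn W)} {T : ArrowsIn W}
    {x y : X.HomColim T}
    (hs : HomColim.mapFunctor (srcFunctor W) x = HomColim.mapFunctor (srcFunctor W) y)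
    (ht : HomColim.mapFunctor (tgtFunctor W) x = HomColim.mapFunctor (tgtFunctor W) y) :
    x = y := by
  obtain ⟨t, g, h, rfl, rfl⟩ := HomColim.exists_rep₂ x y
  -- The sources agree from level `r` on; a further refinement makes the targets agree too.
  obtain ⟨r, a, ha⟩ := HomColim.exists_map_comp_eq' hs
  have ht' : HomColim.mk (mapObj (tgtFunctor W) X) r
        ((tgtFunctor W).map (X.diag.map a ≫ g)) =
      HomColim.mk (mapObj (tgtFunctor W) X) r ((tgtFunctor W).map (X.diag.map a ≫ h)) := by
    rw [Functor.map_comp, Functor.map_comp]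
    exact (HomColim.mk_map_comp (mapObj (tgtFunctor W) X) a _).trans
      (ht.trans (HomColim.mk_map_comp (mapObj (tgtFunctor W) X) a _).symm)
  obtain ⟨q, b, hb⟩ := HomColim.exists_map_comp_eq' ht'
  have e : X.diag.map (b ≫ a) ≫ g = X.diag.map (b ≫ a) ≫ h := by
    apply arrowsIn_hom_ext
    · rw [X.diag.map_comp, Category.assoc, Category.assoc, Functor.map_comp,
        Functor.map_comp _ _ (X.diag.map a ≫ h), Functor.map_comp, Functor.map_comp _ _ h]
      exact congrArg (fun k => (srcFunctor W).map (X.diag.map b) ≫ k) ha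
    · rw [X.diag.map_comp, Category.assoc, Category.assoc, Functor.map_comp,
        Functor.map_comp _ _ (X.diag.map a ≫ h)]
      exact hb
  rw [← HomColim.mk_map_comp X (b ≫ a) g, e, HomColim.mk_map_comp]

/-- Fullness at one level of the target: the square of representatives commutes in the colimit,
hence at some level `r`, where it is a map of arrows. -/
theorem HomColim.exists_arrowsIn {X : ProObj.{w} (ArrowsIn W)} {T : ArrowsIn W}
    (x : (mapObj (srcFunctor W) X).HomColim ((srcFunctor W).obj T))
    (y : (mapObj (tgtFunctor W) X).HomColim ((tgtFunctor W).obj T))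
    (h : HomColim.map _ ((srcToTgt W).app T) x =
      Hom.precomp (levelMap (Functor.whiskerLeft X.diag (srcToTgt W))) y) :
    ∃ z : X.HomColim T, HomColim.mapFunctor (srcFunctor W) z = x ∧
      HomColim.mapFunctor (tgtFunctor W) z = y := by
  obtain ⟨t₁, g₁, rfl⟩ := HomColim.exists_rep x
  obtain ⟨t₂, g₂, rfl⟩ := HomColim.exists_rep y
  obtain ⟨r, a, b, hab⟩ := HomColim.exists_map_comp_eq
    (X := mapObj (srcFunctor W) X) (t := t₁) (t' := t₂) (g := g₁ ≫ (srcToTgt W).app T)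
    (g' := (srcToTgt W).app (X.diag.obj t₂) ≫ g₂) h
  refine ⟨HomColim.mk X r (arrowsInHomMk ((srcFunctor W).map (X.diag.map a) ≫ g₁)
    ((tgtFunctor W).map (X.diag.map b) ≫ g₂) ?_), ?_, ?_⟩
  · refine (Category.assoc _ _ _).trans (hab.trans ?_)
    refine (Category.assoc _ _ _).symm.trans (Eq.trans ?_ (Category.assoc _ _ _))
    exact congrArg (fun k => k ≫ g₂) ((srcToTgt W).naturality (X.diag.map b))
  · exact HomColim.mk_map_comp (mapObj (srcFunctor W) X) a g₁
  · exact HomColim.mk_map_comp (mapObj (tgtFunctor W) X) b g₂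

variable (W)

/-- The functor from pro-objects of arrows to arrows of pro-objects. -/
def proToArrow : ProObj.{w} (ArrowsIn W) ⥤ Arrow (ProObj.{w} C) where
  obj X := Arrow.mk ((mapProNatTrans (srcToTgt W)).app X)
  map f := Arrow.homMk ((mapPro (srcFunctor W)).map f) ((mapPro (tgtFunctor W)).map f)
    ((mapProNatTrans (srcToTgt W)).naturality f)

instance : (proToArrow.{w} W).Faithful where
  map_injective {X Y} f g h := by
    have hs : (mapPro (srcFunctor W)).map f = (mapPro (srcFunctor W)).map g :=
      congrArg CommaMorphism.left h
    have ht : (mapPro (tgtFunctor W)).map f = (mapPro (tgtFunctor W)).map g :=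
      congrArg CommaMorphism.right h
    ext s
    exact HomColim.arrowsIn_ext (congr_fun (congrArg Hom.comp hs) s)
      (congr_fun (congrArg Hom.comp ht) s)

instance : (proToArrow.{w} W).Full where
  map_surjective {X Y} φ := by
    let l : (mapPro (srcFunctor W)).obj X ⟶ (mapPro (srcFunctor W)).obj Y := φ.left
    let r : (mapPro (tgtFunctor W)).obj X ⟶ (mapPro (tgtFunctor W)).obj Y := φ.right
    have hlr : l ≫ (mapProNatTrans (srcToTgt W)).app Y =
        (mapProNatTrans (srcToTgt W)).app X ≫ r := φ.w
    have h (s : Y.Index) := HomColim.exists_arrowsIn (X := X) (T := Y.diag.obj s)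
      (Hom.comp l s) (Hom.comp r s) (congr_fun (congrArg Hom.comp hlr) s)
    choose z hz hz' using h
    refine ⟨Hom.mk z fun {s s'} b => ?_, ?_⟩
    -- The lifts `z s` are chosen independently; their uniqueness makes them compatible.
    · apply HomColim.arrowsIn_ext
      · rw [HomColim.mapFunctor_map, hz, hz]
        exact hom_comp_map l b
      · rw [HomColim.mapFunctor_map, hz', hz']
        exact hom_comp_map r b
    · exact Arrow.hom_ext _ _ (hom_ext (f := (mapPro (srcFunctor W)).map _) (g := l) hz)
        (hom_ext (f := (mapPro (tgtFunctor W)).map _) (g := r) hz')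

variable {W}

theorem proToArrow_essImage {X Y : ProObj.{w} C} {f : X ⟶ Y} (hf : essentiallyOfType W f) :
    (proToArrow.{w} W).essImage (Arrow.mk f) := by
  obtain ⟨L, hL⟩ := hf
  let D : L.I ⥤ ArrowsIn W := ObjectProperty.lift _
    { obj := fun s => Arrow.mk (L.natTrans.app s)
      map := fun a => Arrow.homMk (L.source.map a) (L.target.map a) (L.natTrans.naturality a) } hL
  exact ⟨of D, ⟨(Arrow.isoMk L.sourceIso L.targetIso L.comm.symm :
    Arrow.mk f ≅ Arrow.mk (levelMap L.natTrans)).symm⟩⟩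

/-- Converse of `proToArrow_essImage`: the levels of `Z` lie in `W` by construction. -/
theorem essentiallyOfType_of_iso (Z : ProObj.{w} (ArrowsIn W)) {X Y : ProObj.{w} C} {f : X ⟶ Y}
    (e : X ≅ (mapPro (srcFunctor W)).obj Z) (e' : Y ≅ (mapPro (tgtFunctor W)).obj Z)
    (h : f ≫ e'.hom = e.hom ≫ (mapProNatTrans (srcToTgt W)).app Z) :
    essentiallyOfType W f :=
  ⟨{  I := Z.Index
      source := Z.diag ⋙ srcFunctor W
      target := Z.diag ⋙ tgtFunctor W
      natTrans := Functor.whiskerLeft Z.diag (srcToTgt W)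
      sourceIso := e
      targetIso := e'
      comm := h }, fun s => (Z.diag.obj s).property⟩

instance (J : Type w) [SmallCategory.{w} J] [IsCofiltered J] :
    (essentiallyOfType.{w} W).IsStableUnderLimitsOfShape J where
  condition X Y c₁ c₂ h₁ h₂ α hα φ hφ := by
    let A : J ⥤ Arrow (ProObj.{w} C) :=
      { obj := fun j => Arrow.mk (α.app j)
        map := fun u => Arrow.homMk (X.map u) (Y.map u) (α.naturality u) }
    have hA (j : J) : (proToArrow.{w} W).essImage (A.obj j) := proToArrow_essImage (hα j)
    let Q : J ⥤ ProObj.{w} (ArrowsIn W) := Functor.essImage.liftFunctor A (proToArrow W) hA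
    let i : Q ⋙ proToArrow W ≅ A := Functor.essImage.liftFunctorCompIso A (proToArrow W) hA
    let iX : X ≅ Q ⋙ mapPro (srcFunctor W) := (Functor.isoWhiskerRight i Arrow.leftFunc).symm
    let iY : Y ≅ Q ⋙ mapPro (tgtFunctor W) := (Functor.isoWhiskerRight i Arrow.rightFunc).symm
    have hi (j : J) : α.app j ≫ iY.hom.app j =
        iX.hom.app j ≫ (mapProNatTrans (srcToTgt W)).app (Q.obj j) :=
      (Arrow.w (i.inv.app j)).symm
    let hX := isLimitMapProLimitCone Q (srcFunctor W)
    let hY := isLimitMapProLimitCone Q (tgtFunctor W)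
    let e : c₁.pt ≅ (mapPro (srcFunctor W)).obj (limitObj Q) :=
      h₁.conePointsIsoOfNatIso hX iX
    let e' : c₂.pt ≅ (mapPro (tgtFunctor W)).obj (limitObj Q) :=
      h₂.conePointsIsoOfNatIso hY iY
    -- It remains to identify the induced map `φ` with the levelwise one, which is tested on the
    -- projections of the target limit.
    refine essentiallyOfType_of_iso (limitObj Q) e e' (hY.hom_ext fun j => ?_)
    have he : e.hom ≫ (mapPro (srcFunctor W)).map (limitProj Q j) =
        c₁.π.app j ≫ iX.hom.app j := h₁.conePointsIsoOfNatIso_hom_comp hX iX j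
    have he' : e'.hom ≫ (mapPro (tgtFunctor W)).map (limitProj Q j) =
        c₂.π.app j ≫ iY.hom.app j := h₂.conePointsIsoOfNatIso_hom_comp hY iY j
    change (φ ≫ e'.hom) ≫ (mapPro (tgtFunctor W)).map (limitProj Q j) =
      (e.hom ≫ (mapProNatTrans (srcToTgt W)).app (limitObj Q)) ≫
        (mapPro (tgtFunctor W)).map (limitProj Q j)
    rw [Category.assoc, Category.assoc, he', ← (mapProNatTrans (srcToTgt W)).naturality,
      reassoc_of% he, ← hi, reassoc_of% (hφ j)]

end Arrows

end ProObj

/-- For every small cofiltered category `J`, limits of shape `J` exist in pro-`𝒞`, and the maps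
essentially of type `W` are closed under them: if `X Y : J ⥤ ProObj 𝒞`, if `α : X ⟶ Y` has all its
components essentially of type `W`, then so is the map that `α` induces on the limits. -/
theorem corollary5p2 {𝒞 : Type u} [Category.{v} 𝒞] (W : MorphismProperty 𝒞)
    (J : Type w) [SmallCategory.{w} J] [IsCofiltered J] :
    HasLimitsOfShape J (ProObj.{w} 𝒞) ∧
      (ProObj.essentiallyOfType.{w} W).IsStableUnderLimitsOfShape J :=
  ⟨inferInstance, inferInstance⟩
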